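/- Let $H$ be a complex Hilbert space (not assumed separable), let $\mathcal{M}\subseteq B(H)$ be a von Neumann algebra, and let $\phi=\{\phi_t\}_{t\ge 0}$ be a CP-semigroup on $\mathcal{M}$. That is, each $\phi_t:\mathcal{M}\to\mathcal{M}$ is a linear map that is completely positive, contractive ($\|\phi_t(A)\|\le\|A\|$ for all $A\in\mathcal M$) and normal (continuous for the $\sigma$-weak topology of $\mathcal M$), and 1. $\phi_0=\mathrm{id}_{\mathcal M}$ and $\phi_{s+t}=\phi_s\circ\phi_t$ for all $s,t\ge 0$; 2. for all $A\in\mathcal M$ and $\xi,\eta\in H$ the function $[0,\infty)\ni t\mapsto\langle\phi_t(A)\xi,\eta\rangle$ is continuous. Then $\phi$ is continuous in the point-strong operator topology: for all $A\in\mathcal M$, $\xi\in H$ and $t_0\ge 0$, $$\lim_{t\to t_0}\|\phi_t(A)\xi-\phi_{t_0}(A)\xi\|=0 ,$$ where the limit is over $t\in[0,\infty)$ and is two-sided when $t_0>0$. -/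

import Mathlib

open scoped NNReal InnerProductSpace CStarAlgebra Topology

/-! ### A von Neumann algebra, acting on a Hilbert space, as an ordered C⋆-algebra

The algebraic structure, the norm and the order of `M : VonNeumannAlgebra H` are those which it
inherits from `H →L[ℂ] H` (with the operator norm and the Loewner order). -/

section VonNeumannInstances

universe u

variable {H : Type u} [NormedAddCommGroup H] [InnerProductSpace ℂ H] [CompleteSpace H]

instance VonNeumannAlgebra.instSMulMemClass :
    SMulMemClass (VonNeumannAlgebra H) ℂ (H →L[ℂ] H) where
  smul_mem {s} c {x} hx := s.toStarSubalgebra.smul_mem (x := x) hx c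

theorem VonNeumannAlgebra.isClosed_coe (M : VonNeumannAlgebra H) :
    IsClosed (M : Set (H →L[ℂ] H)) := by
  rw [← M.centralizer_centralizer]
  exact Set.isClosed_centralizer _

noncomputable instance VonNeumannAlgebra.instCStarAlgebraCoe (M : VonNeumannAlgebra H) :
    CStarAlgebra M :=
  StarSubalgebra.cstarAlgebra M (h_closed := M.isClosed_coe)

/-- The Loewner order, restricted to `M`. -/
noncomputable instance VonNeumannAlgebra.instPartialOrderCoe (M : VonNeumannAlgebra H) : PartialOrder M :=
  Subtype.partialOrder _

theorem VonNeumannAlgebra.sqrt_mem (M : VonNeumannAlgebra H) {x : H →L[ℂ] H} (hx : x ∈ M) :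
    CFC.sqrt x ∈ M := by
  rw [← SetLike.mem_coe, ← M.centralizer_centralizer, Set.mem_centralizer_iff]
  intro y hy
  have hxy : Commute x y := (Set.mem_centralizer_iff.mp hy) x hx
  exact (hxy.cfcₙ_nnreal NNReal.sqrt).symm

instance VonNeumannAlgebra.instStarOrderedRingCoe (M : VonNeumannAlgebra H) :
    StarOrderedRing M := by
  refine StarOrderedRing.of_nonneg_iff' ?_ ?_
  · intro x y hxy z
    have h : (x : H →L[ℂ] H) ≤ y := hxy
    exact (add_le_add_right h (z : H →L[ℂ] H) : _)
  · intro x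
    constructor
    · intro hx
      have h : (0 : H →L[ℂ] H) ≤ x := hx
      refine ⟨⟨CFC.sqrt (x : H →L[ℂ] H), M.sqrt_mem x.2⟩, Subtype.ext ?_⟩
      change (x : H →L[ℂ] H) = star (CFC.sqrt (x : H →L[ℂ] H)) * CFC.sqrt (x : H →L[ℂ] H)
      rw [(CFC.sqrt_nonneg (x : H →L[ℂ] H)).isSelfAdjoint.star_eq, CFC.sqrt_mul_sqrt_self _ h]
    · rintro ⟨s, rfl⟩
      exact (star_mul_self_nonneg (s : H →L[ℂ] H) : _)

end VonNeumannInstances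

/-! ### Normal maps and CP-semigroups -/

section CPSemigroups

universe u

variable {H : Type u} [NormedAddCommGroup H] [InnerProductSpace ℂ H] [CompleteSpace H]

/-- The `σ`-weak (ultraweak) topology of `M`: the coarsest topology for which all functionals
`x ↦ ∑ₙ ⟪ξₙ, x ηₙ⟫` with `∑ₙ ‖ξₙ‖² < ∞` and `∑ₙ ‖ηₙ‖² < ∞` are continuous. (The series
converges absolutely, by the Cauchy-Schwarz inequality.) -/
@[reducible]
noncomputable def VonNeumannAlgebra.sigmaWeakTopology (M : VonNeumannAlgebra H) :
    TopologicalSpace M :=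
  ⨅ (ξ : lp (fun _ : ℕ => H) 2) (η : lp (fun _ : ℕ => H) 2),
    TopologicalSpace.induced
      (fun x : M => ∑' n, ⟪ξ n, (x : H →L[ℂ] H) (η n)⟫_ℂ) inferInstance

/-- A map of `M` into itself is normal if it is continuous for the `σ`-weak topology. -/
def VonNeumannAlgebra.IsNormalMap (M : VonNeumannAlgebra H) (Φ : M → M) : Prop :=
  Continuous[M.sigmaWeakTopology, M.sigmaWeakTopology] Φ

/-- A CP-semigroup on `M`: a semigroup, indexed by `t ≥ 0`, of completely positive, contractive
and normal linear maps of `M` into itself that is continuous in the point-weak operator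
topology. -/
structure IsCPSemigroup (M : VonNeumannAlgebra H) (φ : ℝ≥0 → (M →CP M)) : Prop where
  contractive : ∀ (t : ℝ≥0) (A : M), ‖φ t A‖ ≤ ‖A‖
  normal : ∀ t : ℝ≥0, M.IsNormalMap (φ t)
  map_zero : ∀ A : M, φ 0 A = A
  map_add : ∀ (s t : ℝ≥0) (A : M), φ (s + t) A = φ s (φ t A)
  continuous_weak : ∀ (A : M) (ξ η : H),
    Continuous fun t : ℝ≥0 => ⟪η, (φ t A : H →L[ℂ] H) ξ⟫_ℂ

end CPSemigroups

/-!
Strong continuity from the right is a consequence of the Kadison-Schwarz inequality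
`φ_t(A)⋆ φ_t(A) ≤ φ_t(A⋆A)` (`CompletelyPositiveMap.star_map_mul_map_le`): it bounds
`‖φ_t(A)ξ - Aξ‖²` by a function of `t` that is continuous by weak continuity and vanishes at `t = 0`
(`IsCPSemigroup.tendsto_nhds_zero`). The semigroup law moves this to any `t₀`.

From the left, let `t < t₀`, `h = t₀ - t` and `Z_h = |φ_h(A) - A|²`. Since
`φ_{t₀}(A) - φ_t(A) = φ_t(φ_h(A) - A)`, Kadison-Schwarz gives
`‖φ_{t₀}(A)ξ - φ_t(A)ξ‖² ≤ ⟪ξ, φ_t(Z_h)ξ⟫`. The `Z_h` are bounded and, by continuity at `0`, tend to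
`0` on every functional in the predual of `M`. One such functional is `x ↦ ⟪ξ, φ_{t₀}(x)ξ⟫`, because
`φ_{t₀}` is normal. So it is enough that `t ↦ (x ↦ ⟪ξ, φ_t(x)ξ⟫)` is continuous from the left at
`t₀` in the norm of the predual (`IsCPSemigroup.tendsto_norm_comp_sub`).

That is an instance of the principle that a weakly continuous semigroup of contractions of a Banach
space is strongly continuous at positive times, proved here without integration. The predual is
realized as the norm-closed span of the vector functionals in the dual of `M`, and its dual is `M`
(`VonNeumannAlgebra.exists_eval_eq_of_bidual`). By Hahn-Banach, weakly continuous maps of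
`[0, ∞)` into it have norm-separable range, so by Baire's theorem they have small norm oscillation on some interval below
`t₀` (`VonNeumannAlgebra.exists_open_norm_sub_le`). As the semigroup is contractive, the oscillation
remains small at all later times, hence at `t₀`.
-/

/-! ### The Kadison-Schwarz inequality -/

section KadisonSchwarz

variable {A : Type*} [CStarAlgebra A] [PartialOrder A] [StarOrderedRing A]

theorem CStarMatrix.nonneg_quadraticForm {n : Type*} [Fintype n] {P : CStarMatrix n n A}
    (hP : 0 ≤ P) (v : n → A) : 0 ≤ ∑ i, ∑ j, star (v i) * P i j * v j := by
  rw [StarOrderedRing.nonneg_iff] at hP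
  induction hP using AddSubmonoid.closure_induction with
  | zero => simp
  | add P Q _ _ hP hQ =>
    simpa [mul_add, add_mul, Finset.sum_add_distrib] using add_nonneg hP hQ
  | mem P hP =>
    obtain ⟨S, rfl⟩ := hP
    have h : ∑ i, ∑ j, star (v i) * (star S * S) i j * v j =
        ∑ k, star (∑ i, S k i * v i) * ∑ j, S k j * v j := by
      simp only [CStarMatrix.mul_apply, CStarMatrix.star_apply, star_sum, star_mul,
        Finset.mul_sum, Finset.sum_mul, mul_assoc]
      refine (Finset.sum_congr rfl fun i _ => Finset.sum_comm).trans ?_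
      rw [Finset.sum_comm]
      exact Finset.sum_congr rfl fun k _ => Finset.sum_comm
    rw [h]
    exact Finset.sum_nonneg fun k _ => star_mul_self_nonneg _

/-- The Kadison-Schwarz inequality for a contractive completely positive map. It needs only
positivity on `2 × 2` matrices, applied to the matrix with rows `(x⋆x, x⋆)` and `(x, 1)`. -/
theorem CompletelyPositiveMap.star_map_mul_map_le (φ : A →CP A) (hφ : ∀ x, ‖φ x‖ ≤ ‖x‖) (x : A) :
    star (φ x) * φ x ≤ φ (star x * x) := by
  -- `star S * S` has rows `(star x * x, star x)` and `(x, 1)`.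
  let S : CStarMatrix (Fin 2) (Fin 2) A := CStarMatrix.ofMatrix !![x, 1; 0, 0]
  have hpos : 0 ≤ (star S * S).map φ := φ.map_cstarMatrix_nonneg _ (star_mul_self_nonneg S)
  have hstar : φ (star x) = star (φ x) := by
    have h := CStarMatrix.star_apply_of_isSelfAdjoint (IsSelfAdjoint.of_nonneg hpos)
      (i := 0) (j := 1)
    simp [S, CStarMatrix.mul_apply, CStarMatrix.star_apply, CStarMatrix.map_apply] at h
    rw [← h, star_star]
  have hone : φ 1 ≤ 1 := by
    have h0 : 0 ≤ φ 1 := map_nonneg φ zero_le_one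
    rw [← CStarAlgebra.norm_le_one_iff_of_nonneg _ h0]
    refine (hφ 1).trans ?_
    nontriviality A
    exact CStarRing.norm_one.le
  -- The quadratic form of the image, at `(1, -φ x)`, is
  -- `φ (x⋆x) - 2 (φ x)⋆ (φ x) + (φ x)⋆ (φ 1) (φ x)`, and `φ 1 ≤ 1`.
  have h := CStarMatrix.nonneg_quadraticForm hpos ![1, -φ x]
  simp [S, CStarMatrix.mul_apply, CStarMatrix.star_apply, CStarMatrix.map_apply,
    Fin.sum_univ_two, hstar] at h
  have h' := star_left_conjugate_le_conjugate hone (φ x)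
  rw [mul_one] at h'
  have hsum := add_le_add h h'
  rw [zero_add] at hsum
  generalize φ (star x * x) = p, star (φ x) * φ x = q, star (φ x) * φ 1 * φ x = r at hsum ⊢
  have e : p + -q + (-q + r) + q = p - q + r := by abel
  rwa [e, le_add_iff_nonneg_left, sub_nonneg] at hsum

end KadisonSchwarz

/-! ### Separation of a point from a closed subspace -/

theorem Submodule.exists_dual_eq_zero_of_notMem {E : Type*} [NormedAddCommGroup E]
    [NormedSpace ℂ E] {p : Submodule ℂ E} (hp : IsClosed (p : Set E)) {x : E} (hx : x ∉ p) :
    ∃ g : StrongDual ℂ E, (∀ y ∈ p, g y = 0) ∧ g x ≠ 0 := by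
  have hne : p.mkQL x ≠ 0 := fun h0 => hx ((Submodule.Quotient.mk_eq_zero p).mp h0)
  obtain ⟨g, hg⟩ := SeparatingDual.exists_ne_zero (R := ℂ) hne
  refine ⟨g ∘L p.mkQL, fun y hy => ?_, hg⟩
  have hy0 : p.mkQL y = 0 := (Submodule.Quotient.mk_eq_zero p).mpr hy
  rw [ContinuousLinearMap.comp_apply, hy0, map_zero]

namespace VonNeumannAlgebra

variable {H : Type*} [NormedAddCommGroup H] [InnerProductSpace ℂ H] [CompleteSpace H]

/-! ### The predual -/

/-- The vector functional `x ↦ ⟪η, x ξ⟫` on `M`. -/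
noncomputable def vectorFunctional (M : VonNeumannAlgebra H) (η ξ : H) : StrongDual ℂ M :=
  LinearMap.mkContinuous
    { toFun := fun x => ⟪η, (x : H →L[ℂ] H) ξ⟫_ℂ
      map_add' := fun x y => by
        rw [← inner_add_right]; rfl
      map_smul' := fun c x => by
        rw [RingHom.id_apply, smul_eq_mul, ← inner_smul_right]; rfl } (‖η‖ * ‖ξ‖) fun x => by
    refine (norm_inner_le_norm _ _).trans ?_
    have h : ‖(x : H →L[ℂ] H) ξ‖ ≤ ‖x‖ * ‖ξ‖ := (x : H →L[ℂ] H).le_opNorm ξ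
    calc ‖η‖ * ‖(x : H →L[ℂ] H) ξ‖ ≤ ‖η‖ * (‖x‖ * ‖ξ‖) := by gcongr
      _ = ‖η‖ * ‖ξ‖ * ‖x‖ := by ring

variable (M : VonNeumannAlgebra H)

@[simp]
theorem vectorFunctional_apply (η ξ : H) (x : M) :
    M.vectorFunctional η ξ x = ⟪η, (x : H →L[ℂ] H) ξ⟫_ℂ := rfl

theorem norm_vectorFunctional_le (η ξ : H) : ‖M.vectorFunctional η ξ‖ ≤ ‖η‖ * ‖ξ‖ :=
  LinearMap.mkContinuous_norm_le _ (by positivity) _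

/-- The predual of `M`, as the norm-closed span of the vector functionals in the dual of `M`. -/
noncomputable def predual : Submodule ℂ (StrongDual ℂ M) :=
  (Submodule.span ℂ (Set.range fun p : H × H => M.vectorFunctional p.1 p.2)).topologicalClosure

theorem isClosed_predual : IsClosed (M.predual : Set (StrongDual ℂ M)) :=
  Submodule.isClosed_topologicalClosure _

theorem vectorFunctional_mem_predual (η ξ : H) : M.vectorFunctional η ξ ∈ M.predual :=
  Submodule.le_topologicalClosure _ (Submodule.subset_span ⟨(η, ξ), rfl⟩)

variable {M}

theorem predual_le {p : Submodule ℂ (StrongDual ℂ M)}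
    (hp : IsClosed (p : Set (StrongDual ℂ M))) (h : ∀ η ξ, M.vectorFunctional η ξ ∈ p) :
    M.predual ≤ p := by
  refine Submodule.topologicalClosure_minimal _ (Submodule.span_le.mpr ?_) hp
  rintro _ ⟨q, rfl⟩
  exact h _ _

/-- `M` is the dual of its predual: a bounded functional on the dual of `M` agrees on the predual
with evaluation at some `b : M`. The operator `b` represents the sesquilinear form
`(η, ξ) ↦ f (x ↦ ⟪η, x ξ⟫)`, and it lies in `M` by the double commutant theorem. -/
theorem exists_eval_eq_of_bidual (f : StrongDual ℂ (StrongDual ℂ M)) :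
    ∃ b : M, ∀ ω ∈ M.predual, f ω = ω b := by
  let B : H →L⋆[ℂ] H →L[ℂ] ℂ := LinearMap.mkContinuous₂
    (LinearMap.mk₂'ₛₗ (starRingEnd ℂ) (RingHom.id ℂ) (fun η ξ => f (M.vectorFunctional η ξ))
      (fun η η' ξ => by
        rw [← map_add]; congr 1; ext x; simp)
      (fun c η ξ => by
        rw [← map_smul]; congr 1; ext x; simp [mul_comm])
      (fun η ξ ξ' => by
        rw [← map_add]; congr 1; ext x; simp)
      (fun c η ξ => by
        rw [← map_smul]; congr 1; ext x; simp)) ‖f‖ (fun η ξ => by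
        rw [mul_assoc]
        exact f.le_of_opNorm_le_of_le le_rfl (M.norm_vectorFunctional_le η ξ))
  let b : H →L[ℂ] H := (InnerProductSpace.continuousLinearMapOfBilin B).adjoint
  have hb (η ξ : H) : ⟪η, b ξ⟫_ℂ = f (M.vectorFunctional η ξ) := by
    rw [ContinuousLinearMap.adjoint_inner_right,
      InnerProductSpace.continuousLinearMapOfBilin_apply]
    rfl
  have hbM : b ∈ M := by
    rw [← SetLike.mem_coe, ← M.centralizer_centralizer, Set.mem_centralizer_iff]
    intro c hc
    ext ξ
    refine ext_inner_left ℂ fun η => ?_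
    -- On `M`, moving `c` across the inner product does not change the vector functional.
    have hv : M.vectorFunctional η (c ξ) = M.vectorFunctional (c.adjoint η) ξ := by
      ext x
      have hx := Set.mem_centralizer_iff.mp hc x x.2
      have hx' : (x : H →L[ℂ] H) (c ξ) = c ((x : H →L[ℂ] H) ξ) := DFunLike.congr_fun hx ξ
      rw [vectorFunctional_apply, vectorFunctional_apply, hx',
        ContinuousLinearMap.adjoint_inner_left]
    change ⟪η, c (b ξ)⟫_ℂ = ⟪η, b (c ξ)⟫_ℂ
    rw [hb, hv, ← hb, ContinuousLinearMap.adjoint_inner_left]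
  refine ⟨⟨b, hbM⟩, fun ω hω => ?_⟩
  have hle : M.predual ≤ (f - ContinuousLinearMap.apply ℂ ℂ (⟨b, hbM⟩ : M)).ker := by
    refine predual_le (ContinuousLinearMap.isClosed_ker _) fun η ξ => ?_
    simp [hb]
  simpa [sub_eq_zero] using hle hω

theorem exists_series_mem_predual (ξ η : lp (fun _ : ℕ => H) 2) :
    ∃ ω ∈ M.predual, ∀ x : M, ω x = ∑' n, ⟪ξ n, (x : H →L[ℂ] H) (η n)⟫_ℂ := by
  have hs : Summable fun n => M.vectorFunctional (ξ n) (η n) := by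
    refine Summable.of_norm_bounded (g := fun n => ‖ξ n‖ * ‖η n‖) ?_
      fun n => M.norm_vectorFunctional_le _ _
    exact lp.summable_mul (p := 2) (q := 2) (by norm_num; exact Real.HolderConjugate.two_two) ξ η
  refine ⟨∑' n, M.vectorFunctional (ξ n) (η n), ?_, fun x => ?_⟩
  · exact M.isClosed_predual.mem_of_tendsto hs.hasSum
      (Filter.Eventually.of_forall fun s => Submodule.sum_mem _ fun n _ =>
        M.vectorFunctional_mem_predual _ _)
  · exact ((ContinuousLinearMap.apply ℂ ℂ x).map_tsum hs)

theorem continuous_vectorFunctional (η ξ : H) :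
    Continuous[M.sigmaWeakTopology, inferInstance] (M.vectorFunctional η ξ) := by
  have h : ⇑(M.vectorFunctional η ξ) = fun x : M => ∑' n,
      ⟪lp.single (E := fun _ : ℕ => H) 2 0 η n,
        (x : H →L[ℂ] H) (lp.single (E := fun _ : ℕ => H) 2 0 ξ n)⟫_ℂ := by
    ext x
    rw [tsum_eq_single 0 fun n hn => by simp [lp.single_apply, hn]]
    simp
  rw [h]
  exact continuous_iInf_dom (continuous_iInf_dom continuous_induced_dom)

/-- A `σ`-weakly continuous functional lies in the predual: it is a linear combination of
finitely many of the functionals that generate the `σ`-weak topology. -/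
theorem mem_predual_of_continuous (ω : StrongDual ℂ M)
    (hω : Continuous[M.sigmaWeakTopology, inferInstance] ω) : ω ∈ M.predual := by
  choose F hF hFapp using fun p : lp (fun _ : ℕ => H) 2 × lp (fun _ : ℕ => H) 2 =>
    exists_series_mem_predual (M := M) p.1 p.2
  have hmem : (ω : M →ₗ[ℂ] ℂ) ∈ Submodule.span ℂ (Set.range fun p => (F p : M →ₗ[ℂ] ℂ)) := by
    rw [LinearMap.mem_span_iff_continuous]
    convert! hω using 1
    rw [iInf_prod]
    refine iInf_congr fun ξ => iInf_congr fun η => ?_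
    congr 1
    ext x
    exact hFapp (ξ, η) x
  have hrange : (Set.range fun p => (F p : M →ₗ[ℂ] ℂ)) =
      ContinuousLinearMap.coeLM ℂ '' Set.range F := by
    rw [← Set.range_comp]; rfl
  rw [hrange, ← Submodule.map_span] at hmem
  obtain ⟨ω', hω', h⟩ := hmem
  obtain rfl : ω' = ω := ContinuousLinearMap.coe_injective h
  refine (Submodule.span_le.mpr ?_ : _ ≤ M.predual) hω'
  rintro _ ⟨p, rfl⟩
  exact hF p

theorem IsNormalMap.comp_mem_predual {Φ : M →L[ℂ] M} (hΦ : M.IsNormalMap Φ)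
    {ω : StrongDual ℂ M} (hω : ω ∈ M.predual) : ω ∘L Φ ∈ M.predual := by
  let R : StrongDual ℂ M →L[ℂ] StrongDual ℂ M :=
    (ContinuousLinearMap.compL ℂ M M ℂ).flip Φ
  have hle : M.predual ≤ M.predual.comap (R : StrongDual ℂ M →ₗ[ℂ] StrongDual ℂ M) := by
    refine predual_le (M.isClosed_predual.preimage R.continuous) fun η ξ => ?_
    have hc : Continuous[M.sigmaWeakTopology, inferInstance] (M.vectorFunctional η ξ ∘ Φ) :=
      @Continuous.comp _ _ _ M.sigmaWeakTopology M.sigmaWeakTopology _ _ _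
        (continuous_vectorFunctional η ξ) hΦ
    exact mem_predual_of_continuous _ hc
  exact hle hω

/-! ### Weakly continuous maps into the predual -/

/-- Hahn-Banach in the duality of the predual with `M`. -/
theorem mem_closure_span_of_predual {s : Set (StrongDual ℂ M)} (hs : s ⊆ M.predual)
    {ω : StrongDual ℂ M} (hω : ω ∈ M.predual)
    (h : ∀ b : M, (∀ ψ ∈ s, ψ b = 0) → ω b = 0) :
    ω ∈ (Submodule.span ℂ s).topologicalClosure := by
  by_contra hωp
  obtain ⟨g, hg, hgω⟩ := Submodule.exists_dual_eq_zero_of_notMem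
    (Submodule.isClosed_topologicalClosure _) hωp
  obtain ⟨b, hb⟩ := exists_eval_eq_of_bidual g
  refine hgω ((hb ω hω).trans (h b fun ψ hψ => ?_))
  rw [← hb ψ (hs hψ)]
  exact hg ψ (Submodule.le_topologicalClosure _ (Submodule.subset_span hψ))

/-- A map into the predual that is continuous for evaluation at each element of `M` has
norm-separable range: its range lies in the closed span of its values on a countable dense set. -/
theorem isSeparable_range_of_continuous_eval {X : Type*} [TopologicalSpace X]
    [TopologicalSpace.SeparableSpace X] {ω : X → StrongDual ℂ M} (hω : ∀ x, ω x ∈ M.predual)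
    (hc : ∀ b : M, Continuous fun x => ω x b) :
    TopologicalSpace.IsSeparable (Set.range ω) := by
  obtain ⟨D, hD, hDd⟩ := TopologicalSpace.exists_countable_dense X
  refine ((hD.image ω).isSeparable.span (R := ℂ)).closure.mono ?_
  rintro _ ⟨x, rfl⟩
  refine mem_closure_span_of_predual (Set.image_subset_iff.mpr fun y _ => hω y) (hω x)
    fun b hb => ?_
  have : (fun x => ω x b) = fun _ => 0 := by
    refine Continuous.ext_on hDd (hc b) continuous_const fun y hy => ?_
    exact hb _ ⟨y, hy, rfl⟩
  exact congrFun this x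

/-- A map into the predual that is continuous for evaluation at each element of `M` has small norm
oscillation on some nonempty open subset of any given one. Its range is covered by countably many
small closed balls, whose preimages are closed because the norm is a supremum of evaluations; so
Baire's theorem applies. -/
theorem exists_open_norm_sub_le {X : Type*} [TopologicalSpace X] [BaireSpace X]
    [TopologicalSpace.SeparableSpace X] {ω : X → StrongDual ℂ M} (hω : ∀ x, ω x ∈ M.predual)
    (hc : ∀ b : M, Continuous fun x => ω x b) {U : Set X} (hU : IsOpen U) (hUne : U.Nonempty)
    {ε : ℝ} (hε : 0 < ε) :
    ∃ V ⊆ U, IsOpen V ∧ V.Nonempty ∧ ∀ x ∈ V, ∀ y ∈ V, ‖ω x - ω y‖ ≤ ε := by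
  obtain ⟨C, hC, hCd⟩ := isSeparable_range_of_continuous_eval hω hc
  have : Countable C := hC.to_subtype
  let F : C → Set X := fun c => {x | ‖ω x - c‖ ≤ ε / 2}
  have hFc (c : C) : IsClosed (F c) := by
    have hF : F c = ⋂ b : M, {x | ‖ω x b - (c : StrongDual ℂ M) b‖ ≤ ε / 2 * ‖b‖} := by
      ext x
      simp only [F, Set.mem_ofPred_eq, Set.mem_iInter]
      exact ContinuousLinearMap.opNorm_le_iff (half_pos hε).le
    rw [hF]
    exact isClosed_iInter fun b =>
      isClosed_le ((hc b).sub continuous_const).norm continuous_const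
  have hFu : ⋃ c, F c = Set.univ := by
    refine Set.eq_univ_of_forall fun x => ?_
    obtain ⟨c, hcC, hcx⟩ := Metric.mem_closure_iff.mp (hCd ⟨x, rfl⟩) (ε / 2) (half_pos hε)
    refine Set.mem_iUnion.mpr ⟨⟨c, hcC⟩, ?_⟩
    rw [dist_eq_norm] at hcx
    exact hcx.le
  obtain ⟨x, hxU, hx⟩ := (dense_iUnion_interior_of_closed hFc hFu).inter_open_nonempty U hU hUne
  obtain ⟨c, hxc⟩ := Set.mem_iUnion.mp hx
  refine ⟨U ∩ interior (F c), Set.inter_subset_left, hU.inter isOpen_interior, ⟨x, hxU, hxc⟩, ?_⟩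
  intro y hy z hz
  have h1 : ‖ω y - c‖ ≤ ε / 2 := (interior_subset hy.2 : y ∈ F c)
  have h2 : ‖ω z - c‖ ≤ ε / 2 := (interior_subset hz.2 : z ∈ F c)
  calc ‖ω y - ω z‖ = ‖(ω y - c) - (ω z - c)‖ := by rw [sub_sub_sub_cancel_right]
    _ ≤ ‖ω y - c‖ + ‖ω z - c‖ := norm_sub_le _ _
    _ ≤ ε := by linarith

end VonNeumannAlgebra

/-! ### Strong continuity of CP-semigroups -/

section StrongContinuity

open Filter

variable {H : Type*} [NormedAddCommGroup H] [InnerProductSpace ℂ H] [CompleteSpace H]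

variable {M : VonNeumannAlgebra H}

/-- A bounded family in `M` that tends to `0` on vector functionals tends to `0` on the whole
predual. -/
theorem VonNeumannAlgebra.tendsto_zero_of_mem_predual {X : Type*} {l : Filter X} {b : X → M}
    {C : ℝ} (hC : ∀ x, ‖b x‖ ≤ C)
    (hb : ∀ η ξ, Tendsto (fun x => M.vectorFunctional η ξ (b x)) l (𝓝 0))
    {ω : StrongDual ℂ M} (hω : ω ∈ M.predual) : Tendsto (fun x => ω (b x)) l (𝓝 0) := by
  let p : Submodule ℂ (StrongDual ℂ M) :=
    { carrier := {ω | Tendsto (fun x => ω (b x)) l (𝓝 0)}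
      add_mem' := fun {ω ω'} h h' => by
        have := Tendsto.add h h'
        rwa [add_zero] at this
      zero_mem' := tendsto_const_nhds
      smul_mem' := fun c ω h => by
        have := Tendsto.const_mul c h
        rwa [mul_zero] at this }
  refine VonNeumannAlgebra.predual_le (p := p) (isClosed_of_closure_subset fun ω hω => ?_) hb hω
  change Tendsto (fun x => ω (b x)) l (𝓝 0)
  rw [NormedAddGroup.tendsto_nhds_zero]
  intro ε hε
  rcases isEmpty_or_nonempty X with hX | ⟨⟨x₀⟩⟩
  · exact Eventually.of_forall fun x => hX.elim x
  have hC0 : 0 ≤ C := (norm_nonneg _).trans (hC x₀)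
  obtain ⟨ω', hω', hd⟩ := Metric.mem_closure_iff.mp hω (ε / 2 / (C + 1)) (by positivity)
  filter_upwards [(NormedAddGroup.tendsto_nhds_zero.mp hω') (ε / 2) (half_pos hε)] with x hx
  rw [dist_eq_norm, lt_div_iff₀ (by positivity)] at hd
  have h1 : ‖(ω - ω') (b x)‖ ≤ ‖ω - ω'‖ * (C + 1) :=
    (ω - ω').le_of_opNorm_le_of_le le_rfl ((hC x).trans (by linarith))
  calc ‖ω (b x)‖ = ‖(ω - ω') (b x) + ω' (b x)‖ := by simp
    _ ≤ ‖(ω - ω') (b x)‖ + ‖ω' (b x)‖ := norm_add_le _ _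
    _ < ε := by linarith

namespace IsCPSemigroup

variable {φ : ℝ≥0 → (M →CP M)} (hφ : IsCPSemigroup M φ)

/-- The map `φ t`, as a bounded linear map. -/
noncomputable def toCLM (t : ℝ≥0) : M →L[ℂ] M :=
  LinearMap.mkContinuous (φ t).toLinearMap 1 fun A => by
    rw [one_mul]; exact hφ.contractive t A

include hφ

/-- The Kadison-Schwarz inequality, evaluated at a vector. -/
theorem norm_apply_sq_le (t : ℝ≥0) (A : M) (ξ : H) :
    ‖(φ t A : H →L[ℂ] H) ξ‖ ^ 2 ≤
      RCLike.re (M.vectorFunctional ξ ξ (φ t (star A * A))) := by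
  have h : star (φ t A : H →L[ℂ] H) * (φ t A : H →L[ℂ] H) ≤ φ t (star A * A) :=
    (φ t).star_map_mul_map_le (hφ.contractive t) A
  have h' := (ContinuousLinearMap.le_def _ _).mp h |>.re_inner_nonneg_right ξ
  have h2 : ⟪ξ, (star (φ t A : H →L[ℂ] H) * (φ t A : H →L[ℂ] H)) ξ⟫_ℂ =
      (‖(φ t A : H →L[ℂ] H) ξ‖ : ℂ) ^ 2 := by
    rw [ContinuousLinearMap.star_eq_adjoint, mul_apply_eq_comp,
      ContinuousLinearMap.adjoint_inner_right, inner_self_eq_norm_sq_to_K]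
    rfl
  rw [_root_.sub_apply, inner_sub_right, map_sub, h2, ← Complex.ofReal_pow] at h'
  exact sub_nonneg.mp h'

/-- Strong continuity at `t = 0`. -/
theorem tendsto_nhds_zero (A : M) (ξ : H) :
    Tendsto (fun t => (φ t A : H →L[ℂ] H) ξ) (𝓝 0) (𝓝 ((A : H →L[ℂ] H) ξ)) := by
  set ζ := (A : H →L[ℂ] H) ξ with hζ
  -- This function bounds `‖φ t A ξ - A ξ‖ ^ 2`: expand the square and apply Kadison-Schwarz to
  -- `‖φ t A ξ‖ ^ 2`.
  have hc : Continuous fun t => RCLike.re (M.vectorFunctional ξ ξ (φ t (star A * A))) -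
      2 * RCLike.re ⟪ζ, (φ t A : H →L[ℂ] H) ξ⟫_ℂ + ‖ζ‖ ^ 2 :=
    ((RCLike.continuous_re.comp (hφ.continuous_weak _ _ _)).sub
      (continuous_const.mul (RCLike.continuous_re.comp (hφ.continuous_weak _ _ _)))).add
      continuous_const
  have h0 : RCLike.re (M.vectorFunctional ξ ξ (φ 0 (star A * A))) -
      2 * RCLike.re ⟪ζ, (φ 0 A : H →L[ℂ] H) ξ⟫_ℂ + ‖ζ‖ ^ 2 = 0 := by
    have h2 : M.vectorFunctional ξ ξ (star A * A) = ⟪ζ, ζ⟫_ℂ := by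
      rw [hζ, ← ContinuousLinearMap.adjoint_inner_right]
      rfl
    rw [hφ.map_zero, hφ.map_zero, h2, inner_self_eq_norm_sq]
    ring
  have hlim := hc.tendsto 0
  rw [h0] at hlim
  have hsq : Tendsto (fun t => ‖(φ t A : H →L[ℂ] H) ξ - ζ‖ ^ 2) (𝓝 0) (𝓝 0) := by
    refine squeeze_zero (fun t => by positivity) (fun t => ?_) hlim
    rw [norm_sub_sq (𝕜 := ℂ), inner_re_symm]
    linarith [hφ.norm_apply_sq_le t A ξ]
  rw [tendsto_iff_norm_sub_tendsto_zero]
  simpa using hsq.sqrt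

/-- The semigroup which `φ` induces on the predual is norm-continuous from the left at every
`t₀ > 0`, on vector functionals. A small oscillation near some `c < t₀` spreads to `t₀` because
the induced maps are contractions. -/
theorem tendsto_norm_comp_sub (ξ : H) {t₀ : ℝ≥0} (ht₀ : 0 < t₀) :
    Tendsto (fun t => ‖M.vectorFunctional ξ ξ ∘L hφ.toCLM t -
      M.vectorFunctional ξ ξ ∘L hφ.toCLM t₀‖) (𝓝[≤] t₀) (𝓝 0) := by
  set ω : ℝ≥0 → StrongDual ℂ M := fun t => M.vectorFunctional ξ ξ ∘L hφ.toCLM t with hω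
  rw [NormedAddGroup.tendsto_nhds_zero]
  intro ε hε
  obtain ⟨V, hVt, hV, ⟨c, hcV⟩, hVε⟩ := VonNeumannAlgebra.exists_open_norm_sub_le (ω := ω)
    (fun t => VonNeumannAlgebra.IsNormalMap.comp_mem_predual (Φ := hφ.toCLM t) (hφ.normal t)
      (M.vectorFunctional_mem_predual ξ ξ))
    (fun b => hφ.continuous_weak b ξ ξ) (isOpen_Iio (a := t₀)) ⟨0, ht₀⟩ (half_pos hε)
  have hlim : Tendsto (fun t => c + (t₀ - t)) (𝓝[≤] t₀) (𝓝 c) := by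
    have h : Continuous fun t => c + (t₀ - t) := by fun_prop
    have := h.tendsto t₀
    rw [tsub_self, add_zero] at this
    exact this.mono_left nhdsWithin_le_nhds
  filter_upwards [hlim.eventually (hV.mem_nhds hcV), self_mem_nhdsWithin,
    nhdsWithin_le_nhds (lt_mem_nhds (hVt hcV : c < t₀))] with t htV htt₀ hct
  -- With `d = t - c` and `r = t₀ - t`, one has `t = c + d` and `t₀ = (c + r) + d`, and `c + r ∈ V`.
  have key : ω t - ω t₀ = (ω c - ω (c + (t₀ - t))) ∘L hφ.toCLM (t - c) := by
    have h1 : t = c + (t - c) := (add_tsub_cancel_of_le hct.le).symm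
    have h2 : t₀ = c + (t₀ - t) + (t - c) := by
      rw [add_right_comm, ← h1, add_tsub_cancel_of_le htt₀]
    ext b
    have e1 : φ t b = φ c (φ (t - c) b) := by rw [← hφ.map_add, ← h1]
    have e2 : φ t₀ b = φ (c + (t₀ - t)) (φ (t - c) b) := by rw [← hφ.map_add, ← h2]
    change M.vectorFunctional ξ ξ (φ t b) - M.vectorFunctional ξ ξ (φ t₀ b) = _
    rw [e1, e2]
    rfl
  have hle : ‖ω t - ω t₀‖ ≤ ε / 2 * 1 := by
    rw [key]
    refine (ContinuousLinearMap.opNorm_comp_le _ _).trans ?_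
    gcongr
    · exact hVε _ hcV _ htV
    · exact LinearMap.mkContinuous_norm_le _ zero_le_one _
  rw [norm_norm]
  linarith

theorem tendsto_comp_star_mul_self (A : M) {ω : StrongDual ℂ M} (hω : ω ∈ M.predual) :
    Tendsto (fun t => ω (star (φ t A - A) * (φ t A - A))) (𝓝 0) (𝓝 0) := by
  refine VonNeumannAlgebra.tendsto_zero_of_mem_predual (C := (2 * ‖A‖) ^ 2) (fun t => ?_)
    (fun η ξ => ?_) hω
  · rw [CStarRing.norm_star_mul_self, sq]
    have : ‖φ t A - A‖ ≤ 2 * ‖A‖ := (norm_sub_le _ _).trans (by linarith [hφ.contractive t A])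
    gcongr
  · have h (ζ : H) : Tendsto (fun t => (φ t A : H →L[ℂ] H) ζ - (A : H →L[ℂ] H) ζ) (𝓝 0) (𝓝 0) :=
      tendsto_sub_nhds_zero_iff.mpr (hφ.tendsto_nhds_zero A ζ)
    have h2 := (h η).inner (𝕜 := ℂ) (h ξ)
    rw [inner_zero_left] at h2
    refine h2.congr fun t => ?_
    exact (ContinuousLinearMap.adjoint_inner_right (φ t A - A : H →L[ℂ] H) η _).symm

/-- Strong continuity from the left. With `h = t₀ - t` and `Z h = |φ h A - A| ^ 2`, the squared
norm in question is at most `⟪ξ, φ t (Z h) ξ⟫`. By norm continuity on the predual, `φ t` may be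
replaced by the fixed map `φ t₀`, and `Z h` tends to `0` on the predual. -/
theorem tendsto_left (A : M) (ξ : H) {t₀ : ℝ≥0} (ht₀ : 0 < t₀) :
    Tendsto (fun t => ‖(φ t A : H →L[ℂ] H) ξ - (φ t₀ A : H →L[ℂ] H) ξ‖) (𝓝[≤] t₀) (𝓝 0) := by
  set ω : ℝ≥0 → StrongDual ℂ M := fun t => M.vectorFunctional ξ ξ ∘L hφ.toCLM t with hω
  set Z : ℝ≥0 → M := fun h => star (φ h A - A) * (φ h A - A) with hZ
  have hZle (h : ℝ≥0) : ‖Z h‖ ≤ (2 * ‖A‖) ^ 2 := by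
    rw [hZ, CStarRing.norm_star_mul_self, sq]
    have : ‖φ h A - A‖ ≤ 2 * ‖A‖ := (norm_sub_le _ _).trans (by linarith [hφ.contractive h A])
    gcongr
  have hsub : Tendsto (fun t => t₀ - t) (𝓝[≤] t₀) (𝓝 0) := by
    have h : Continuous fun t : ℝ≥0 => t₀ - t := by fun_prop
    have := h.tendsto t₀
    rw [tsub_self] at this
    exact this.mono_left nhdsWithin_le_nhds
  have h1 := (hφ.tendsto_norm_comp_sub ξ ht₀).mul_const ((2 * ‖A‖) ^ 2)
  have h2 := ((hφ.tendsto_comp_star_mul_self A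
    (VonNeumannAlgebra.IsNormalMap.comp_mem_predual (Φ := hφ.toCLM t₀) (hφ.normal t₀)
      (M.vectorFunctional_mem_predual ξ ξ))).comp hsub).norm
  have hlim := h1.add h2
  rw [zero_mul, norm_zero, zero_add] at hlim
  have hsq : Tendsto (fun t => ‖(φ t A : H →L[ℂ] H) ξ - (φ t₀ A : H →L[ℂ] H) ξ‖ ^ 2)
      (𝓝[≤] t₀) (𝓝 0) := by
    refine squeeze_zero' (Eventually.of_forall fun t => by positivity) ?_ hlim
    filter_upwards [self_mem_nhdsWithin] with t ht
    have e : φ t (φ (t₀ - t) A - A) = φ t₀ A - φ t A := by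
      rw [map_sub, ← hφ.map_add, add_tsub_cancel_of_le ht]
    calc ‖(φ t A : H →L[ℂ] H) ξ - (φ t₀ A : H →L[ℂ] H) ξ‖ ^ 2
        = ‖(φ t (φ (t₀ - t) A - A) : H →L[ℂ] H) ξ‖ ^ 2 := by rw [e, norm_sub_rev]; rfl
      _ ≤ RCLike.re (ω t (Z (t₀ - t))) := hφ.norm_apply_sq_le _ _ _
      _ ≤ ‖ω t (Z (t₀ - t))‖ := RCLike.re_le_norm _
      _ = ‖(ω t - ω t₀) (Z (t₀ - t)) + ω t₀ (Z (t₀ - t))‖ := by simp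
      _ ≤ ‖(ω t - ω t₀) (Z (t₀ - t))‖ + ‖ω t₀ (Z (t₀ - t))‖ := norm_add_le _ _
      _ ≤ ‖ω t - ω t₀‖ * (2 * ‖A‖) ^ 2 + ‖ω t₀ (Z (t₀ - t))‖ := by
        gcongr
        exact (ω t - ω t₀).le_of_opNorm_le_of_le le_rfl (hZle _)
  simpa using hsq.sqrt

theorem tendsto_right (A : M) (ξ : H) (t₀ : ℝ≥0) :
    Tendsto (fun t => ‖(φ t A : H →L[ℂ] H) ξ - (φ t₀ A : H →L[ℂ] H) ξ‖) (𝓝[≥] t₀) (𝓝 0) := by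
  have hsub : Tendsto (fun t => t - t₀) (𝓝[≥] t₀) (𝓝 0) := by
    have h : Continuous fun t : ℝ≥0 => t - t₀ := by fun_prop
    have := h.tendsto t₀
    rw [tsub_self] at this
    exact this.mono_left nhdsWithin_le_nhds
  have h0 := tendsto_iff_norm_sub_tendsto_zero.mp (hφ.tendsto_nhds_zero (φ t₀ A) ξ)
  refine (h0.comp hsub).congr' ?_
  filter_upwards [self_mem_nhdsWithin] with t ht
  rw [Function.comp_apply, ← hφ.map_add, tsub_add_cancel_of_le ht]

end IsCPSemigroup

end StrongContinuity

theorem mainTheorem12 {H : Type*} [NormedAddCommGroup H] [InnerProductSpace ℂ H]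
    [CompleteSpace H] (M : VonNeumannAlgebra H) (φ : ℝ≥0 → (M →CP M))
    (hφ : IsCPSemigroup M φ) (A : M) (ξ : H) (t₀ : ℝ≥0) :
    Filter.Tendsto
      (fun t : ℝ≥0 => ‖(φ t A : H →L[ℂ] H) ξ - (φ t₀ A : H →L[ℂ] H) ξ‖)
      (nhds t₀) (nhds 0) := by
  rw [← nhdsLE_sup_nhdsGE]
  refine Filter.Tendsto.sup ?_ (hφ.tendsto_right A ξ t₀)
  rcases eq_or_ne t₀ 0 with rfl | ht₀
  · exact (hφ.tendsto_right A ξ 0).mono_left (nhdsWithin_mono _ fun t _ => Set.mem_Ici.mpr zero_le)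
  · exact hφ.tendsto_left A ξ (pos_iff_ne_zero.mpr ht₀)
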